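/- Let $X$ and $Y$ be separable real Banach spaces with duals $X'$ and $Y'$. Assume that $X$ is reflexive, that $X'$ is strictly convex, and that $X$ has a Schauder basis (a finite basis if $\dim X<\infty$). Let $X_n$ be the span of the first $n$ basis vectors (all of $X$ if $n\ge\dim X$), and let $P_n\in L(X,X)$ be projections onto $X_n$ with $\sup_n\|P_n\|<\infty$, for instance the canonical projections of the basis. Let $A:X\to Y'$ be a (possibly nonlinear) weak-*-continuous map, i.e. $x_n\rightharpoonup x$ in $X$ implies $A(x_n)\stackrel{*}{\rightharpoonup}A(x)$ in $Y'$, and let $b\in Y'$. Suppose there are 1. a map $\Psi:X\to X'$ (possibly nonlinear) such that - $\|\Psi(x)\|_{X'}\le C\|x\|_X$ for all $x\in X$, with some constant $C$, - $\langle\Psi(x),x\rangle_{X',X}>0$ for all $x\in X\setminus\{0\}$, - $\langle\Psi(z),x-P_nx\rangle_{X',X}=0$ for all $n$, all $z\in X_n$ and all $x\in X$; 2. a surjective bounded linear operator $S\in L(X',Y)$; 3. a number $r>0$ such that $\langle A(x)-b,\,S\Psi(x)\rangle_{Y',Y}\ge 0$ for every $x\in X$ with $\|x\|_X\ge r$.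 Then there exists $x\in X$ with $A(x)=b$ and $\|x\|_X\le r$. -/

import Mathlib

open Filter Topology

/-- A real normed space is reflexive if its canonical embedding into the bidual is onto. -/
def IsReflexiveSpace (X : Type*) [NormedAddCommGroup X] [NormedSpace ℝ X] : Prop :=
  Function.Surjective (NormedSpace.inclusionInDoubleDual ℝ X)

/-- A Schauder basis in the usual sense, which covers finite-dimensional spaces: either a finite
ordered basis `e 0, …, e (d - 1)` (this includes the zero space, `d = 0`), or an infinite
Schauder basis `(e i)`, `i : ℕ`. (Mathlib's `SchauderBasis` is the infinite case only.) -/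
inductive SequentialBasis (X : Type*) [NormedAddCommGroup X] [NormedSpace ℝ X]
  | finite (d : ℕ) (e : Module.Basis (Fin d) ℝ X) : SequentialBasis X
  | infinite (e : SchauderBasis ℝ X) : SequentialBasis X

/-- The subspace `X_n` spanned by the first `n` vectors of the basis. -/
def SequentialBasis.initialSpan {X : Type*} [NormedAddCommGroup X] [NormedSpace ℝ X] :
    SequentialBasis X → ℕ → Submodule ℝ X
  | .finite _ e, n => Submodule.span ℝ (e '' {i | (i : ℕ) < n})
  | .infinite e, n => Submodule.span ℝ (e '' {i | i < n})

/-- `P n` is, for every `n`, a continuous linear projection of `X` onto the span `X_n` of the first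
`n` basis vectors, with norms bounded uniformly in `n`. The canonical projections
`∑ a_i e_i ↦ ∑_{i < n} a_i e_i` of the basis are an example. -/
structure IsBoundedProjectionSequence {X : Type*} [NormedAddCommGroup X] [NormedSpace ℝ X]
    (e : SequentialBasis X) (P : ℕ → X →L[ℝ] X) : Prop where
  mem : ∀ n x, P n x ∈ e.initialSpan n
  eq_self : ∀ n, ∀ x ∈ e.initialSpan n, P n x = x
  bounded : ∃ M : ℝ, ∀ n, ‖P n‖ ≤ M

/-- The three properties of the (in general nonlinear, not necessarily continuous) map `Ψ : X → X'`
relative to the subspaces `X_n` and the projections `P n` onto them. -/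
structure IsDualityTypeMap {X : Type*} [NormedAddCommGroup X] [NormedSpace ℝ X]
    (e : SequentialBasis X) (P : ℕ → X →L[ℝ] X) (Ψ : X → StrongDual ℝ X) : Prop where
  bounded : ∃ C : ℝ, ∀ x, ‖Ψ x‖ ≤ C * ‖x‖
  pos : ∀ x, x ≠ 0 → 0 < Ψ x x
  projected : ∀ n, ∀ z ∈ e.initialSpan n, ∀ x, Ψ z (x - P n x) = 0

/-- Weak-*-continuity of `A : X → Y'`: if `x_n ⇀ x` weakly in `X`, then `A (x_n) ⇀ A x` weakly-*
in `Y'`. -/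
def IsWeakStarContinuous {X Y : Type*} [NormedAddCommGroup X] [NormedSpace ℝ X]
    [NormedAddCommGroup Y] [NormedSpace ℝ Y] (A : X → StrongDual ℝ Y) : Prop :=
  ∀ (u : ℕ → X) (x : X),
    (∀ f : StrongDual ℝ X, Tendsto (fun n => f (u n)) atTop (𝓝 (f x))) →
      ∀ y : Y, Tendsto (fun n => A (u n) y) atTop (𝓝 (A x y))

open Polynomial MeasureTheory Metric

/-! By reflexivity the functional `f ↦ ⟨A x - b, S f⟩` on X' is evaluation at a vector `t x` of X.
Since `S` is onto, `A x = b` exactly when `t x = 0`. The map `t` inherits weak sequential continuity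
from `A`, and `Ψ x (t x) ≥ 0` for `‖x‖ ≥ r`.

The equation `t x = 0` is solved by Galerkin approximation
(`IsDualityTypeMap.exists_galerkin_solution`). On X_n one has `Ψ x (P n (t x)) = Ψ x (t x) ≥ 0` on
the sphere of radius r, while `Ψ x x > 0`. So `P n (t x)` is never a negative multiple of `x` there,
and Brouwer's theorem gives a zero in the ball. A subsequence of these zeros converges weakly to
some x. For fixed z in X_m, `Ψ z (t x) = 0` in the limit; the choice `z = P m (t x)` gives `Ψ z z =
0`, hence `z = 0`. As this holds for all m, `t x = 0`. Only the values of `Ψ` at fixed points enter,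
so `Ψ` need not be continuous.

Brouwer's theorem is proved by the Milnor–Rogers volume argument
(`not_lipschitz_retraction_sphere`). -/

/-! ### Brouwer's theorem by the volume argument -/

lemma ContinuousLinearMap.exists_polynomial_det_one_add_smul {E : Type*}
    [NormedAddCommGroup E] [NormedSpace ℝ E] [FiniteDimensional ℝ E] (L : E →L[ℝ] E) :
    ∃ p : ℝ[X], p.natDegree ≤ Module.finrank ℝ E ∧ ∀ t, p.eval t = (1 + t • L).det := by
  let b := Module.finBasis ℝ E
  refine ⟨Matrix.det ((X : ℝ[X]) • (LinearMap.toMatrix b b L).map C + (1 : Matrix _ _ ℝ).map C),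
    (natDegree_det_X_add_C_le _ _).trans (by simp), fun t => ?_⟩
  have h : ((1 + t • L : E →L[ℝ] E) : E →ₗ[ℝ] E) = 1 + t • (L : E →ₗ[ℝ] E) := rfl
  rw [ContinuousLinearMap.det, ← LinearMap.det_toMatrix b, h, ← coe_evalRingHom, RingHom.map_det]
  congr 1
  ext i j
  by_cases hij : i = j <;> simp [LinearMap.toMatrix_one, hij] <;> ring

/-- Evaluation at `1` of polynomials of degree at most `n` is an affine combination of evaluations
at points arbitrarily close to `0`. -/
lemma Polynomial.exists_eval_one_eq_sum (n : ℕ) {ε : ℝ} (hε : 0 < ε) :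
    ∃ t w : Fin (n + 1) → ℝ, (∀ i, t i ∈ Set.Ioo 0 ε) ∧ ∑ i, w i = 1 ∧
      ∀ p : ℝ[X], p.natDegree ≤ n → p.eval 1 = ∑ i, w i * p.eval (t i) := by
  -- Equally spaced nodes inside `(0, ε)`; the weights are the Lagrange basis polynomials evaluated
  -- at 1.
  let t : Fin (n + 1) → ℝ := fun i => ε * ((i + 1) / (n + 2))
  have ht : Set.InjOn t (Finset.univ : Finset (Fin (n + 1))) := by
    intro i _ j _ hij
    have : (0 : ℝ) < n + 2 := by positivity
    simp only [t] at hij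
    field_simp at hij
    simpa [Fin.ext_iff] using hij
  refine ⟨t, fun i => (Lagrange.basis Finset.univ t i).eval 1, fun i => ⟨by positivity, ?_⟩, ?_, ?_⟩
  · have : ((i : ℕ) : ℝ) < n + 1 := by exact_mod_cast i.2
    refine mul_lt_of_lt_one_right hε ?_
    rw [div_lt_one (by positivity)]
    linarith
  · rw [← eval_finsetSum, Lagrange.sum_basis ht Finset.univ_nonempty, eval_one]
  · intro p hp
    have hd : p.degree < (Finset.univ : Finset (Fin (n + 1))).card := by
      rw [Finset.card_univ, Fintype.card_fin]
      exact degree_le_natDegree.trans_lt (by exact_mod_cast Nat.lt_succ_of_le hp)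
    conv_lhs => rw [Lagrange.eq_interpolate ht hd, Lagrange.interpolate_apply, eval_finsetSum]
    simp [mul_comm]

/-- The determinant is 1 at `t = 0`. If it were not positive at `t`, it would vanish at some `s` in
between, and a kernel vector of `1 + s • L` contradicts `s * ‖L‖ < 1`. -/
lemma ContinuousLinearMap.det_one_add_smul_pos {E : Type*} [NormedAddCommGroup E] [NormedSpace ℝ E]
    [FiniteDimensional ℝ E] {L : E →L[ℝ] E} {t : ℝ} (ht : 0 ≤ t) (h : t * ‖L‖ < 1) :
    0 < (1 + t • L).det := by
  obtain ⟨p, -, hp⟩ := L.exists_polynomial_det_one_add_smul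
  rw [← hp]
  by_contra! hneg
  have h0 : (0 : ℝ) ∈ Set.Icc (p.eval t) (p.eval 0) :=
    ⟨hneg, by rw [hp]; simp [ContinuousLinearMap.det]⟩
  obtain ⟨s, ⟨hs0, hst⟩, hs⟩ := intermediate_value_Icc' ht p.continuous.continuousOn h0
  replace hs : (1 + s • L).det = 0 := hp s ▸ hs
  obtain ⟨v, hv, hv0⟩ := Submodule.exists_mem_ne_zero_of_ne_bot
    (LinearMap.bot_lt_ker_of_det_eq_zero hs).ne'
  have hv' : v + s • L v = 0 := hv
  have h1 : ‖v‖ = s * ‖L v‖ := by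
    rw [← Real.norm_of_nonneg hs0, ← norm_smul, ← norm_neg (s • L v), ← eq_neg_of_add_eq_zero_left hv']
  have h2 : s * ‖L v‖ ≤ t * ‖L‖ * ‖v‖ := by
    rw [mul_assoc]
    exact mul_le_mul hst (L.le_opNorm v) (norm_nonneg _) ht
  have : 0 < ‖v‖ := norm_pos_iff.2 hv0
  nlinarith

/-- There is no Lipschitz map which is the identity off the ball of radius `R`, is differentiable in
that ball, and maps it into its sphere. The volume of the image of the ball under `x ↦ x + t • g x`
is constant for small `t ≥ 0` and polynomial in `t`, but its formal value at `t = 1` is zero. -/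
lemma not_lipschitz_retraction_sphere {E : Type*} [NormedAddCommGroup E] [InnerProductSpace ℝ E]
    [FiniteDimensional ℝ E] {g : E → E} {K : NNReal} (hg : LipschitzWith K g) {R : ℝ} (hR : 0 < R)
    (h0 : ∀ x, R ≤ ‖x‖ → g x = 0) (hd : ∀ x ∈ ball (0 : E) R, DifferentiableAt ℝ g x)
    (hs : ∀ x ∈ ball (0 : E) R, ‖x + g x‖ = R) : False := by
  borelize E
  let μ : Measure E := Measure.addHaar
  set B := ball (0 : E) R
  -- With `t i < 1 / (K + 1)`, each `x + t i • g x` is a perturbation of the identity with Lipschitz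
  -- constant below 1, hence bijective. The degree bound is uniform in x, so one set of nodes and
  -- weights serves every derivative of `g`.
  obtain ⟨t, w, ht, hw, hp⟩ := Polynomial.exists_eval_one_eq_sum (Module.finrank ℝ E)
    (ε := (K + 1 : ℝ)⁻¹) (by positivity)
  have hsmall : ∀ i, t i * K < 1 := fun i => by
    have := (ht i).2
    rw [lt_inv_comm₀ (ht i).1 (by positivity)] at this
    have h2 := mul_lt_mul_of_pos_left this (ht i).1
    rw [mul_inv_cancel₀ (ht i).1.ne'] at h2
    have := (ht i).1
    nlinarith
  have hbij : ∀ i, Function.Bijective fun x => x + t i • g x := fun i => by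
    have happ : ApproximatesLinearOn (fun x => x + t i • g x)
        ((ContinuousLinearEquiv.refl ℝ E : E ≃L[ℝ] E) : E →L[ℝ] E) Set.univ
        (⟨t i, (ht i).1.le⟩ * K) := by
      intro x _ y _
      have := hg.norm_sub_le x y
      have h3 : x + t i • g x - (y + t i • g y) - (x - y) = t i • (g x - g y) := by
        rw [smul_sub]; abel
      change ‖x + t i • g x - (y + t i • g y) - (x - y)‖ ≤ t i * K * ‖x - y‖
      rw [h3, norm_smul, Real.norm_of_nonneg (ht i).1.le, mul_assoc]
      exact mul_le_mul_of_nonneg_left this (ht i).1.le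
    have hc : Subsingleton E ∨ (⟨t i, (ht i).1.le⟩ * K : NNReal) <
        ‖((ContinuousLinearEquiv.refl ℝ E).symm : E →L[ℝ] E)‖₊⁻¹ := by
      rcases subsingleton_or_nontrivial E with h | h
      · exact .inl h
      · right
        have : ‖((ContinuousLinearEquiv.refl ℝ E).symm : E →L[ℝ] E)‖₊ = 1 :=
          ContinuousLinearMap.nnnorm_id (𝕜 := ℝ) (E := E)
        rw [this, inv_one]
        exact_mod_cast hsmall i
    exact ⟨Set.injOn_univ.1 (happ.injOn hc), happ.surjective hc⟩
  -- The map is the identity off `B`: injectivity keeps points of `B` from leaving, and surjectivity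
  -- makes `B` covered by itself.
  have himg : ∀ i, (fun x => x + t i • g x) '' B = B := fun i => by
    have hfix : ∀ x, x ∉ B → x + t i • g x = x := fun x hx => by
      rw [h0 x (by simpa [B] using hx), smul_zero, add_zero]
    ext y
    constructor
    · rintro ⟨x, hx, rfl⟩
      by_contra hy
      have := (hbij i).1 (hfix _ hy)
      exact hy (by simpa only [this] using hx)
    · intro hy
      obtain ⟨x, rfl⟩ := (hbij i).2 y
      by_contra hx
      have hxB : x ∉ B := fun h => hx ⟨x, h, rfl⟩
      exact hxB (by simpa only [hfix x hxB] using hy)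
  have hder : ∀ i, ∀ x ∈ B, HasFDerivWithinAt (fun x => x + t i • g x)
      (1 + t i • fderiv ℝ g x) B x := fun i x hx =>
    ((hasFDerivAt_id x).add ((hd x hx).hasFDerivAt.const_smul (t i))).hasFDerivWithinAt
  have hpos : ∀ i, ∀ x, 0 < (1 + t i • fderiv ℝ g x).det := fun i x => by
    refine ContinuousLinearMap.det_one_add_smul_pos (ht i).1.le ((hsmall i).trans_le' ?_)
    exact mul_le_mul_of_nonneg_left (norm_fderiv_le_of_lipschitz ℝ hg) (ht i).1.le
  have hint : ∀ i, IntegrableOn (fun x => (1 + t i • fderiv ℝ g x).det) B μ := fun i => by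
    have := (integrableOn_image_iff_integrableOn_abs_det_fderiv_smul μ measurableSet_ball
      (hder i) (hbij i).1.injOn (fun _ => (1 : ℝ))).1
      (by rw [himg i]; exact integrableOn_const (measure_ball_lt_top.ne))
    simpa only [abs_of_pos (hpos i _), smul_eq_mul, mul_one] using this
  have hvol : ∀ i, ∫ x in B, (1 + t i • fderiv ℝ g x).det ∂μ = μ.real B := fun i => by
    have := integral_image_eq_integral_abs_det_fderiv_smul μ measurableSet_ball
      (hder i) (hbij i).1.injOn (fun _ => (1 : ℝ))
    rw [himg i] at this
    simpa [abs_of_pos (hpos i _)] using this.symm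
  -- As `‖x + g x‖` is constant on `B`, the range of the derivative is orthogonal to the nonzero
  -- vector `x + g x`, so the derivative is not onto.
  have hzero : ∀ x ∈ B, (1 + fderiv ℝ g x).det = 0 := fun x hx => by
    by_contra hne
    have hf : HasFDerivAt (fun x => x + g x) (1 + fderiv ℝ g x) x :=
      (hasFDerivAt_id x).add (hd x hx).hasFDerivAt
    have h1 := hf.norm_sq
    have h2 : HasFDerivAt (fun x => ‖x + g x‖ ^ 2) (0 : E →L[ℝ] ℝ) x := by
      refine (hasFDerivAt_const (R ^ 2) x).congr_of_eventuallyEq ?_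
      filter_upwards [isOpen_ball.mem_nhds hx] with y hy
      rw [hs y hy]
    have h3 := h1.unique h2
    obtain ⟨v, hv⟩ : ∃ v, (1 + fderiv ℝ g x) v = x + g x :=
      (LinearEquiv.ofIsUnitDet (f := ((1 + fderiv ℝ g x : E →L[ℝ] E) : E →ₗ[ℝ] E))
        (v := Module.finBasis ℝ E) (v' := Module.finBasis ℝ E)
        (by rw [LinearMap.det_toMatrix]; exact isUnit_iff_ne_zero.2 hne)).surjective _
    have h4 := DFunLike.congr_fun h3 v
    rw [smul_apply, ContinuousLinearMap.comp_apply, hv, innerSL_apply_apply,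
      real_inner_self_eq_norm_sq, hs x hx, zero_apply, two_nsmul] at h4
    exact (by positivity : R ^ 2 + R ^ 2 ≠ 0) h4
  have hsum : ∀ x ∈ B, ∑ i, w i * (1 + t i • fderiv ℝ g x).det = 0 := fun x hx => by
    obtain ⟨p, hpn, hpe⟩ := (fderiv ℝ g x).exists_polynomial_det_one_add_smul
    have := hp p hpn
    simp only [hpe, one_smul, hzero x hx] at this
    exact this.symm
  have hI : ∫ x in B, ∑ i, w i * (1 + t i • fderiv ℝ g x).det ∂μ = μ.real B := by
    rw [integral_finsetSum _ fun i _ => (hint i).const_mul (w i)]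
    simp_rw [integral_const_mul, hvol, ← Finset.sum_mul, hw, one_mul]
  rw [setIntegral_congr_fun measurableSet_ball hsum, integral_zero] at hI
  exact (ENNReal.toReal_pos (measure_ball_pos μ (0 : E) hR).ne' measure_ball_lt_top.ne).ne hI

/-- A Lipschitz function on a closed ball that vanishes on the sphere is Lipschitz when extended
by zero. -/
lemma LipschitzOnWith.extend_zero_closedBall {E F : Type*} [NormedAddCommGroup E] [NormedSpace ℝ E]
    [NormedAddCommGroup F] {q : E → F} {K : NNReal} {R : ℝ}
    (hq : LipschitzOnWith K q (closedBall 0 R)) (h0 : ∀ x, ‖x‖ = R → q x = 0) :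
    LipschitzWith K fun x => if ‖x‖ < R then q x else 0 := by
  -- The segment from x to y meets the sphere, where `q` vanishes, at a point no farther from x than
  -- y is.
  have key : ∀ x y, ‖x‖ < R → R ≤ ‖y‖ → dist (q x) 0 ≤ K * dist x y := by
    intro x y hx hy
    have hc : Continuous fun s : ℝ => ‖AffineMap.lineMap x y s‖ :=
      (AffineMap.lineMap_continuous).norm
    obtain ⟨s, ⟨hs0, hs1⟩, hs⟩ := intermediate_value_Icc zero_le_one hc.continuousOn
      (show R ∈ Set.Icc ‖AffineMap.lineMap x y (0 : ℝ)‖ ‖AffineMap.lineMap x y (1 : ℝ)‖ by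
        simpa using ⟨hx.le, hy⟩)
    replace hs : ‖AffineMap.lineMap x y s‖ = R := hs
    rw [← h0 _ hs]
    refine (hq.dist_le_mul x (by simpa using hx.le) _ (by simpa using hs.le)).trans ?_
    rw [dist_left_lineMap, Real.norm_of_nonneg hs0]
    exact mul_le_mul_of_nonneg_left (mul_le_of_le_one_left dist_nonneg hs1) K.2
  refine LipschitzWith.of_dist_le_mul fun x y => ?_
  by_cases hx : ‖x‖ < R <;> by_cases hy : ‖y‖ < R
  · simpa only [hx, hy, if_true] using
      hq.dist_le_mul x (by simpa using hx.le) y (by simpa using hy.le)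
  · simpa only [hx, hy, if_true, if_false] using key x y hx (not_lt.1 hy)
  · simpa only [hx, hy, if_true, if_false, dist_comm] using key y x hy (not_lt.1 hx)
  · simp only [hx, hy, if_false, dist_self]
    positivity

/-- Without a fixed point, each x in the ball can be moved along the line through `H x` and x, in
the direction `u x = x - H x`, to the sphere. The displacement `q` comes from the larger root s of
`‖x + s • u x‖² = R²`, whose reduced discriminant is `D`. Since `‖H x‖ < R`, `⟪x, u x⟫ > 0` on the
sphere; so `q = 0` there, and `D > 0` on the closed ball, which makes the square root smooth up to
the boundary. -/
lemma exists_fixedPoint_of_contDiff {E : Type*} [NormedAddCommGroup E] [InnerProductSpace ℝ E]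
    [FiniteDimensional ℝ E] {H : E → E} (hH : ContDiff ℝ 1 H) {R : ℝ} (hR : ∀ x, ‖H x‖ < R) :
    ∃ x, H x = x := by
  by_contra! hne
  have hR0 : 0 < R := (norm_nonneg _).trans_lt (hR 0)
  set u : E → E := fun x => x - H x with hu
  have hu0 : ∀ x, 0 < ‖u x‖ ^ 2 := fun x => by
    have := norm_pos_iff.2 (sub_ne_zero.2 (hne x).symm)
    positivity
  have huc : ContDiff ℝ 1 u := contDiff_id.sub hH
  set D : E → ℝ := fun x => inner ℝ x (u x) ^ 2 + ‖u x‖ ^ 2 * (R ^ 2 - ‖x‖ ^ 2) with hD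
  have hDc : ContDiff ℝ 1 D := ((contDiff_id.inner ℝ huc).pow 2).add
    ((huc.norm_sq ℝ).mul (contDiff_const.sub (contDiff_id.norm_sq ℝ)))
  have hsphere : ∀ x, ‖x‖ = R → 0 < inner ℝ x (u x) := fun x hx => by
    have h1 := real_inner_le_norm x (H x)
    have h2 := hR x
    simp only [hu, inner_sub_right, real_inner_self_eq_norm_sq]
    rw [hx] at h1 ⊢
    nlinarith
  have hDpos : ∀ x, ‖x‖ ≤ R → 0 < D x := fun x hx => by
    rcases hx.lt_or_eq with h | h
    · have : 0 < R ^ 2 - ‖x‖ ^ 2 := by nlinarith [norm_nonneg x]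
      have := mul_pos (hu0 x) this
      simp only [hD]
      positivity
    · have := hsphere x h
      simp only [hD, h, sub_self, mul_zero, add_zero]
      positivity
  set q : E → E := fun x => ((-inner ℝ x (u x) + √(D x)) / ‖u x‖ ^ 2) • u x with hq
  have hqc : ∀ x, ‖x‖ ≤ R → ContDiffAt ℝ 1 q x := fun x hx =>
    (((contDiff_id.inner ℝ huc).neg.contDiffAt.add (hDc.contDiffAt.sqrt (hDpos x hx).ne')).div
      (huc.norm_sq ℝ).contDiffAt (hu0 x).ne').smul huc.contDiffAt
  have hq0 : ∀ x, ‖x‖ = R → q x = 0 := fun x hx => by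
    have : D x = inner ℝ x (u x) ^ 2 := by simp [hD, hx]
    simp only [hq]
    rw [this, Real.sqrt_sq (hsphere x hx).le, neg_add_cancel, zero_div, zero_smul]
  have hqR : ∀ x, ‖x‖ ≤ R → ‖x + q x‖ = R := fun x hx => by
    have h1 := Real.sq_sqrt (hDpos x hx).le
    have h2 := hu0 x
    rw [← sq_eq_sq₀ (norm_nonneg _) hR0.le]
    simp only [hq]
    rw [norm_add_sq_real, real_inner_smul_right, norm_smul, mul_pow, Real.norm_eq_abs, sq_abs]
    generalize √(D x) = d at *
    simp only [hD] at h1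
    generalize inner ℝ x (u x) = a at *
    generalize ‖u x‖ ^ 2 = c at *
    field_simp
    linear_combination h1
  obtain ⟨K, hK⟩ := ContDiffOn.exists_lipschitzOnWith
    (fun x hx => (hqc x (by simpa using hx)).contDiffWithinAt : ContDiffOn ℝ 1 q (closedBall 0 R))
    one_ne_zero (convex_closedBall 0 R) (isCompact_closedBall 0 R)
  refine not_lipschitz_retraction_sphere (hK.extend_zero_closedBall hq0) hR0
    (fun x hx => if_neg hx.not_gt) (fun x hx => ?_) fun x hx => ?_
  · have hx' : ‖x‖ < R := by simpa using hx
    refine ((hqc x hx'.le).differentiableAt one_ne_zero).congr_of_eventuallyEq ?_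
    filter_upwards [isOpen_ball.mem_nhds hx] with y hy
    exact if_pos (by simpa using hy)
  · have hx' : ‖x‖ < R := by simpa using hx
    simp only [hx', if_true]
    exact hqR x hx'.le

/-- Smooth approximations of `G` have fixed points, which are almost fixed by `G` and lie in one
compact ball; there `dist (G x) x` attains its minimum, which must be 0. -/
lemma exists_fixedPoint_of_continuous_of_bounded {E : Type*} [NormedAddCommGroup E]
    [InnerProductSpace ℝ E] [FiniteDimensional ℝ E] {G : E → E} (hG : Continuous G) {R : ℝ}
    (hR : ∀ x, ‖G x‖ ≤ R) : ∃ x, G x = x := by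
  have hR0 : 0 ≤ R := (norm_nonneg _).trans (hR 0)
  -- Values of `G` differ by at most `2 * R`, so the smooth approximation is bounded by `3 * R` and
  -- its fixed points have norm below `3 * R + 1`. One more unit leaves room for the smoothing
  -- radius.
  have hu : UniformContinuousOn G (closedBall 0 (3 * R + 2)) :=
    (isCompact_closedBall _ _).uniformContinuousOn_of_continuous hG.continuousOn
  have happrox : ∀ ε > 0, ∃ x ∈ closedBall (0 : E) (3 * R + 1), dist (G x) x ≤ ε := by
    intro ε hε
    obtain ⟨δ, hδ, hGδ⟩ := Metric.uniformContinuousOn_iff.1 hu ε hε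
    obtain ⟨H, hH, hHG⟩ := hG.exists_contDiff_dist_le_of_forall_mem_ball_dist_le
      (lt_min hδ one_pos)
    have hHR : ∀ x, ‖H x‖ < 3 * R + 1 := by
      intro x
      have h1 : dist (H x) (G x) ≤ 2 * R := hHG x _ fun y _ => by
        rw [dist_eq_norm]
        linarith [norm_sub_le (G y) (G x), hR x, hR y]
      rw [dist_eq_norm] at h1
      linarith [norm_le_norm_add_norm_sub' (H x) (G x), hR x]
    obtain ⟨x, hx⟩ := exists_fixedPoint_of_contDiff (hH.of_le (by norm_cast)) hHR
    have hxR : ‖x‖ < 3 * R + 1 := hx ▸ hHR x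
    refine ⟨x, by simpa using hxR.le, ?_⟩
    nth_rw 2 [← hx]
    rw [dist_comm]
    refine hHG x _ fun y hy => ?_
    rw [mem_ball, lt_min_iff] at hy
    refine (hGδ y ?_ x ?_ hy.1).le
    · rw [mem_closedBall_zero_iff]
      have := hy.2
      rw [dist_eq_norm] at this
      linarith [norm_le_norm_add_norm_sub' y x]
    · rw [mem_closedBall_zero_iff]
      linarith
  obtain ⟨x, -, hx⟩ := (isCompact_closedBall (0 : E) (3 * R + 1)).exists_isMinOn
    ⟨0, mem_closedBall_self (by positivity)⟩ (hG.dist continuous_id).continuousOn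
  by_contra! hne
  have hpos := dist_pos.2 (hne x)
  obtain ⟨y, hy, hyε⟩ := happrox _ (half_pos hpos)
  have : dist (G x) x ≤ dist (G y) y := hx hy
  linarith

/-- **Brouwer's fixed point theorem**, for bounded continuous self-maps of a finite-dimensional
normed space. -/
theorem exists_fixedPoint_of_bounded_range {V : Type*} [NormedAddCommGroup V] [NormedSpace ℝ V]
    [FiniteDimensional ℝ V] {F : V → V} (hF : Continuous F) {R : ℝ} (hR : ∀ x, ‖F x‖ ≤ R) :
    ∃ x, F x = x := by
  let φ := toEuclidean (E := V)
  obtain ⟨y, hy⟩ := exists_fixedPoint_of_continuous_of_bounded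
    (G := fun y => φ (F (φ.symm y))) (R := ‖φ.toContinuousLinearMap‖ * R)
    (φ.continuous.comp (hF.comp φ.symm.continuous)) fun y =>
      (φ.toContinuousLinearMap.le_opNorm _).trans
        (mul_le_mul_of_nonneg_left (hR _) (norm_nonneg _))
  exact ⟨φ.symm y, φ.injective (by simpa using hy)⟩

/-- A continuous map on a finite-dimensional space which does not point strictly inwards on the
sphere of radius `r` (as seen by an arbitrary, not necessarily continuous, choice of linear
functionals that are positive on the radius) has a zero in the closed ball. -/
theorem exists_zero_of_nonneg_on_sphere {V : Type*} [NormedAddCommGroup V] [NormedSpace ℝ V]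
    [FiniteDimensional ℝ V] {τ : V → V} (hτ : Continuous τ) {r : ℝ} (hr : 0 < r)
    (ℓ : V → V →ₗ[ℝ] ℝ) (hpos : ∀ x, ‖x‖ = r → 0 < ℓ x x)
    (hnonneg : ∀ x, ‖x‖ = r → 0 ≤ ℓ x (τ x)) : ∃ x, τ x = 0 ∧ ‖x‖ ≤ r := by
  by_contra! hne
  -- Radial retraction onto the closed ball. The normalised map `-r τ(ρ x) / ‖τ(ρ x)‖` takes values
  -- in the sphere, so its fixed point x has norm r and is a negative multiple of `τ x`, against the
  -- sign conditions on `ℓ`.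
  set ρ : V → V := fun x => (r / max r ‖x‖) • x with hρ
  have hmax : ∀ x : V, 0 < max r ‖x‖ := fun x => lt_max_of_lt_left hr
  have hρc : Continuous ρ := (continuous_const.div (continuous_const.max continuous_norm)
    fun x => (hmax x).ne').smul continuous_id
  have hρr : ∀ x, ‖ρ x‖ ≤ r := fun x => by
    rw [hρ, norm_smul, Real.norm_of_nonneg (div_nonneg hr.le (hmax x).le), div_mul_eq_mul_div,
      div_le_iff₀ (hmax x)]
    exact mul_le_mul_of_nonneg_left (le_max_right _ _) hr.le
  have hτ0 : ∀ x, 0 < ‖τ (ρ x)‖ := fun x => norm_pos_iff.2 fun h => (hne _ h).not_ge (hρr x)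
  have hFr : ∀ x, ‖(-(r / ‖τ (ρ x)‖)) • τ (ρ x)‖ = r := fun x => by
    rw [norm_smul, norm_neg, Real.norm_of_nonneg (div_nonneg hr.le (hτ0 x).le),
      div_mul_cancel₀ _ (hτ0 x).ne']
  obtain ⟨x, hx⟩ := exists_fixedPoint_of_bounded_range
    (F := fun x => (-(r / ‖τ (ρ x)‖)) • τ (ρ x))
    ((continuous_const.div (hτ.comp hρc).norm fun x => (hτ0 x).ne').neg.smul (hτ.comp hρc))
    fun x => (hFr x).le
  have hxr : ‖x‖ = r := hx ▸ hFr x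
  have hρx : ρ x = x := by simp [hρ, hxr, hr.ne']
  have h1 := hpos x hxr
  have h2 : ℓ x x = -(r / ‖τ x‖) * ℓ x (τ x) := by
    have h := congrArg (ℓ x) hx
    simpa only [hρx, map_smul, smul_eq_mul] using h.symm
  have h3 : 0 ≤ r / ‖τ x‖ := by positivity
  nlinarith [hnonneg x hxr, mul_nonneg h3 (hnonneg x hxr)]

/-! ### Weak sequential compactness in separable reflexive spaces -/

/-- Norming functionals of a dense sequence suffice, because by reflexivity a difference of two
functionals on X' is a vector of X. This makes weak-* compact balls of X'' metrizable, hence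
sequentially compact. -/
lemma IsReflexiveSpace.exists_countable_separating {X : Type*} [NormedAddCommGroup X]
    [NormedSpace ℝ X] [TopologicalSpace.SeparableSpace X] (hX : IsReflexiveSpace X) :
    ∃ f : ℕ → StrongDual ℝ X, ∀ ⦃φ ψ : WeakDual ℝ (StrongDual ℝ X)⦄, φ ≠ ψ →
      ∃ n, φ (f n) ≠ ψ (f n) := by
  choose f hf1 hf using fun n => exists_dual_vector'' ℝ (TopologicalSpace.denseSeq X n)
  refine ⟨f, fun φ ψ hne => ?_⟩
  contrapose! hne
  obtain ⟨w, hw⟩ := hX (WeakDual.toStrongDual (φ - ψ))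
  have hfw : ∀ g : StrongDual ℝ X, g w = φ g - ψ g := fun g => DFunLike.congr_fun hw g
  have hw0 : w = 0 := by
    refine norm_le_zero_iff.1 (le_of_forall_pos_le_add fun ε hε => ?_)
    obtain ⟨n, hn⟩ := (TopologicalSpace.denseRange_denseSeq X).exists_dist_lt w (half_pos hε)
    rw [dist_eq_norm] at hn
    set v := TopologicalSpace.denseSeq X n
    -- `f n` norms v and kills w, so a v close to w must be small, and then so is w.
    have h1 : ‖v‖ ≤ ‖w - v‖ := by
      have h2 : f n (w - v) = -‖v‖ := by
        rw [map_sub, hfw, hne n, hf n, sub_self, zero_sub]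
        rfl
      have h3 := (f n).le_of_opNorm_le (hf1 n) (w - v)
      rwa [h2, norm_neg, norm_norm, one_mul] at h3
    have := norm_le_norm_add_norm_sub' w v
    linarith
  refine DFunLike.ext _ _ fun g => ?_
  have := hfw g
  rw [hw0, map_zero] at this
  exact (sub_eq_zero.1 this.symm)

/-- In a separable reflexive space, bounded sequences have weakly convergent subsequences. -/
lemma IsReflexiveSpace.exists_subseq_tendsto_weakly {X : Type*} [NormedAddCommGroup X]
    [NormedSpace ℝ X] [TopologicalSpace.SeparableSpace X] (hX : IsReflexiveSpace X) {r : ℝ}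
    {u : ℕ → X} (hu : ∀ n, ‖u n‖ ≤ r) :
    ∃ x : X, ‖x‖ ≤ r ∧ ∃ φ : ℕ → ℕ, StrictMono φ ∧
      ∀ f : StrongDual ℝ X, Tendsto (fun n => f (u (φ n))) atTop (𝓝 (f x)) := by
  let J := NormedSpace.inclusionInDoubleDual ℝ X
  let B : Set (WeakDual ℝ (StrongDual ℝ X)) := WeakDual.toStrongDual ⁻¹' closedBall 0 r
  have hB : IsCompact B := WeakDual.isCompact_closedBall 0 r
  obtain ⟨f, hf⟩ := hX.exists_countable_separating
  have : CompactSpace B := isCompact_iff_compactSpace.1 hB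
  have : TopologicalSpace.MetrizableSpace B :=
    Metric.PiNatEmbed.TopologicalSpace.MetrizableSpace.of_countable_separating
      (fun n (φ : B) => (φ : WeakDual ℝ (StrongDual ℝ X)) (f n))
      (fun n => (WeakDual.eval_continuous (f n)).comp continuous_subtype_val)
      fun x y hxy => hf (Subtype.val_injective.ne hxy)
  have hJ : ∀ x, ‖J x‖ = ‖x‖ := (NormedSpace.inclusionInDoubleDualLi (E := X) ℝ).norm_map
  have hJB : ∀ n, StrongDual.toWeakDual (J (u n)) ∈ B := fun n => by
    change J (u n) ∈ closedBall 0 r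
    exact (mem_closedBall_zero_iff (E := StrongDual ℝ (StrongDual ℝ X))).2 ((hJ _).trans_le (hu n))
  obtain ⟨⟨ξ, hξ⟩, φ, hφ, hlim⟩ := CompactSpace.tendsto_subseq
    fun n => (⟨StrongDual.toWeakDual (J (u n)), hJB n⟩ : B)
  obtain ⟨x, hx⟩ := hX (WeakDual.toStrongDual ξ)
  refine ⟨x, ?_, φ, hφ, fun g => ?_⟩
  · have : WeakDual.toStrongDual ξ ∈ closedBall 0 r := hξ
    rw [← hx] at this
    exact (hJ x).symm.trans_le ((mem_closedBall_zero_iff (E := StrongDual ℝ (StrongDual ℝ X))).1 this)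
  · have h1 := ((WeakDual.eval_continuous g).comp continuous_subtype_val).continuousAt.tendsto.comp
      hlim
    have h2 : g x = ξ g := DFunLike.congr_fun hx g
    rw [h2]
    exact h1

/-! ### Basis subspaces and Galerkin approximation -/

namespace SequentialBasis

variable {X : Type*} [NormedAddCommGroup X] [NormedSpace ℝ X] (e : SequentialBasis X)

instance finiteDimensional_initialSpan (n : ℕ) : FiniteDimensional ℝ (e.initialSpan n) := by
  cases e with
  | finite d e => exact FiniteDimensional.span_of_finite ℝ ((Set.toFinite _).image _)
  | infinite e => exact FiniteDimensional.span_of_finite ℝ ((Set.finite_lt_nat n).image _)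

lemma initialSpan_mono : Monotone e.initialSpan := by
  intro m n hmn
  cases e with
  | finite d e => exact Submodule.span_mono (Set.image_mono fun i hi => lt_of_lt_of_le hi hmn)
  | infinite e => exact Submodule.span_mono (Set.image_mono fun i hi => lt_of_lt_of_le hi hmn)

lemma exists_mem_initialSpan_norm_sub_lt (x : X) {ε : ℝ} (hε : 0 < ε) :
    ∃ n, ∃ v ∈ e.initialSpan n, ‖x - v‖ < ε := by
  cases e with
  | finite d e =>
    refine ⟨d, x, ?_, by simpa⟩
    have : {i : Fin d | (i : ℕ) < d} = Set.univ := Set.eq_univ_of_forall fun i => i.2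
    rw [initialSpan, this, Set.image_univ, e.span_eq]
    exact Submodule.mem_top
  | infinite e =>
    obtain ⟨n, hn⟩ := ((Metric.tendsto_nhds.1 (e.tendsto_proj x)) ε hε).exists
    refine ⟨n, e.proj n x, ?_, by rwa [← dist_eq_norm, dist_comm]⟩
    rw [SchauderBasis.proj_apply]
    exact Submodule.sum_mem _ fun i hi => Submodule.smul_mem _ _
      (Submodule.subset_span ⟨i, Finset.mem_range.1 hi, rfl⟩)

end SequentialBasis

lemma IsBoundedProjectionSequence.eq_zero {X : Type*} [NormedAddCommGroup X] [NormedSpace ℝ X]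
    {e : SequentialBasis X} {P : ℕ → X →L[ℝ] X} (hP : IsBoundedProjectionSequence e P) {x : X}
    (hx : ∀ n, P n x = 0) : x = 0 := by
  obtain ⟨M, hM⟩ := hP.bounded
  have hM0 : 0 ≤ M := (norm_nonneg _).trans (hM 0)
  refine norm_le_zero_iff.1 (le_of_forall_pos_le_add fun ε hε => ?_)
  obtain ⟨n, v, hv, hxv⟩ := e.exists_mem_initialSpan_norm_sub_lt x
    (show 0 < ε / (1 + M) by positivity)
  -- Since `P n` kills x and fixes v, this identity bounds `‖x‖` by `(1 + M) * ‖x - v‖`, which the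
  -- choice of v makes less than ε.
  have h1 : x = (x - v) - P n (x - v) := by
    rw [map_sub, hx, hP.eq_self n v hv]
    abel
  have h2 : ‖P n (x - v)‖ ≤ M * ‖x - v‖ := (P n).le_of_opNorm_le (hM n) _
  rw [lt_div_iff₀ (by positivity)] at hxv
  calc ‖x‖ = ‖(x - v) - P n (x - v)‖ := by rw [← h1]
    _ ≤ ‖x - v‖ + ‖P n (x - v)‖ := norm_sub_le _ _
    _ ≤ 0 + ε := by linarith

/-- A map into a finite-dimensional space is continuous if its compositions with all linear
functionals are. -/
lemma continuous_of_forall_strongDual {α V : Type*} [TopologicalSpace α] [NormedAddCommGroup V]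
    [NormedSpace ℝ V] [FiniteDimensional ℝ V] {τ : α → V}
    (h : ∀ f : StrongDual ℝ V, Continuous fun a => f (τ a)) : Continuous τ := by
  let φ := (Module.finBasis ℝ V).equivFunL
  have hφ : Continuous fun a => φ (τ a) := continuous_pi fun i =>
    h ((ContinuousLinearMap.proj (R := ℝ) (φ := fun _ => ℝ) i).comp φ.toContinuousLinearMap)
  exact (φ.symm.continuous.comp hφ).congr fun a => φ.symm_apply_apply _

/-- The Galerkin equations have solutions. -/
lemma IsDualityTypeMap.exists_galerkin_solution {X : Type*} [NormedAddCommGroup X]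
    [NormedSpace ℝ X] {e : SequentialBasis X} {P : ℕ → X →L[ℝ] X}
    (hP : IsBoundedProjectionSequence e P) {Ψ : X → StrongDual ℝ X} (hΨ : IsDualityTypeMap e P Ψ)
    {t : X → X} (ht : ∀ f : StrongDual ℝ X, Continuous fun x => f (t x))
    {r : ℝ} (hr : 0 < r) (hcoer : ∀ x, r ≤ ‖x‖ → 0 ≤ Ψ x (t x)) (n : ℕ) :
    ∃ x ∈ e.initialSpan n, ‖x‖ ≤ r ∧ P n (t x) = 0 := by
  let V := e.initialSpan n
  let Q : X →L[ℝ] V := (P n).codRestrict V (hP.mem n)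
  obtain ⟨x, hx0, hxr⟩ := exists_zero_of_nonneg_on_sphere (V := V) (τ := fun x => Q (t x))
    (continuous_of_forall_strongDual fun f => (ht (f.comp Q)).comp continuous_subtype_val) hr
    (fun x => ((Ψ x).comp V.subtypeL : V →L[ℝ] ℝ))
    (fun x hx => hΨ.pos x fun h => hr.ne' (hx.symm.trans (norm_eq_zero.2 (Subtype.ext h))))
    (fun x hx => by
      -- At a point x of X_n, `Ψ x` does not distinguish `t x` from its projection, so the sign
      -- condition passes to the projected map.
      have h1 := hΨ.projected n x x.2 (t x)
      rw [map_sub, sub_eq_zero] at h1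
      exact (hcoer x hx.ge).trans_eq h1)
  exact ⟨x, x.2, hxr, congrArg Subtype.val hx0⟩

theorem mainTheorem4
    {X : Type*} [NormedAddCommGroup X] [NormedSpace ℝ X] [CompleteSpace X]
    [TopologicalSpace.SeparableSpace X]
    {Y : Type*} [NormedAddCommGroup Y] [NormedSpace ℝ Y] [CompleteSpace Y]
    [TopologicalSpace.SeparableSpace Y]
    (hX : IsReflexiveSpace X) [StrictConvexSpace ℝ (StrongDual ℝ X)]
    (e : SequentialBasis X) (P : ℕ → X →L[ℝ] X) (hP : IsBoundedProjectionSequence e P)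
    (A : X → StrongDual ℝ Y) (hA : IsWeakStarContinuous A) (b : StrongDual ℝ Y)
    (Ψ : X → StrongDual ℝ X) (hΨ : IsDualityTypeMap e P Ψ)
    (S : StrongDual ℝ X →L[ℝ] Y) (hS : Function.Surjective S)
    (r : ℝ) (hr : 0 < r)
    (hcoer : ∀ x : X, r ≤ ‖x‖ → 0 ≤ (A x - b) (S (Ψ x))) :
    ∃ x : X, A x = b ∧ ‖x‖ ≤ r := by
  choose t ht using fun x => hX ((A x - b).comp S)
  replace ht : ∀ x (f : StrongDual ℝ X), f (t x) = (A x - b) (S f) :=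
    fun x f => DFunLike.congr_fun (ht x) f
  have htw : ∀ (u : ℕ → X) (x : X),
      (∀ f : StrongDual ℝ X, Tendsto (fun n => f (u n)) atTop (𝓝 (f x))) →
      ∀ f : StrongDual ℝ X, Tendsto (fun n => f (t (u n))) atTop (𝓝 (f (t x))) := by
    intro u x hu f
    simp only [ht]
    exact (hA u x hu (S f)).sub_const (b (S f))
  have htc : ∀ f : StrongDual ℝ X, Continuous fun x => f (t x) := fun f =>
    continuous_iff_seqContinuous.2 fun u x hu =>
      htw u x (fun g => (g.continuous.tendsto x).comp hu) f
  choose u huV hur hu using hΨ.exists_galerkin_solution hP htc hr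
    fun x hx => (ht x (Ψ x)).symm ▸ hcoer x hx
  obtain ⟨x, hxr, φ, hφ, hlim⟩ := hX.exists_subseq_tendsto_weakly hur
  -- Once `φ k ≥ m`, z lies in X_{φ k}, and the Galerkin equation gives `Ψ z (t (u (φ k))) = Ψ z (P
  -- (φ k) (t (u (φ k)))) = 0`.
  have hzero : ∀ m, ∀ z ∈ e.initialSpan m, Ψ z (t x) = 0 := by
    intro m z hz
    refine tendsto_nhds_unique (htw _ x hlim (Ψ z)) (tendsto_const_nhds.congr' ?_)
    filter_upwards [eventually_ge_atTop m] with k hk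
    have h1 := hΨ.projected (φ k) z (e.initialSpan_mono (hk.trans (hφ.id_le k)) hz) (t (u (φ k)))
    rw [map_sub, hu, map_zero, sub_zero] at h1
    exact h1.symm
  have htx : t x = 0 := hP.eq_zero fun m => by
    by_contra hne
    -- Test with `z = P m (t x)`: then `Ψ z z = Ψ z (t x) = 0`, which positivity forbids unless z =
    -- 0.
    have h1 := hΨ.projected m _ (hP.mem m (t x)) (t x)
    rw [map_sub, hzero m _ (hP.mem m (t x)), zero_sub, neg_eq_zero] at h1
    exact (hΨ.pos _ hne).ne' h1
  refine ⟨x, sub_eq_zero.1 (ContinuousLinearMap.ext fun y => ?_), hxr⟩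
  obtain ⟨f, rfl⟩ := hS y
  rw [← ht, htx, map_zero, zero_apply]
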